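/- \textbf{Theorem (Invertible matrices over $L^1(G)$).} Let $G$ be a (discrete) group, let $I$ be a non-empty directed set, and let $\{G_i \mid i \in I\}$ be a family of normal subgroups of $G$ such that $G_j \subseteq G_i$ whenever $i \le j$ and $\bigcap_{i\in I} G_i = \{1\}$. (The indices $[G:G_i]$ may be infinite.) For a discrete group $H$ let $L^1(H)$ be the ring of formal sums $\sum_{h\in H}\lambda_h\cdot h$ with $\lambda_h\in\mathbb C$ and $\sum_h|\lambda_h|<\infty$, with the convolution product, and for $A \in M_d(L^1(H))$ let $r_A^{(2)}\colon L^2(H)^d\to L^2(H)^d$ be the bounded $H$-equivariant operator given by right multiplication of row vectors with $A$. For a bounded $H$-equivariant operator $f\colon L^2(H)^d\to L^2(H)^d$ let $F(\lambda)=\operatorname{tr}_{\mathcal N(H)}(E_\lambda)$ be its spectral density function, where $\{E_\lambda\}$ is the family of spectral projections of $|f|=(f^*f)^{1/2}$ and $\operatorname{tr}_{\mathcal N(H)}(T)=\sum_{k=1}^d\langle T(e_k),e_k\rangle$ is the von Neumann trace, $e_k\in L^2(H)^d$ being the vector with the unit element of $H$ as its $k$-th entry and zeros elsewhere. The Fuglede--Kadison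 determinant of $f$ is \[ {\det}^{(2)}_{\mathcal N(H)}(f)=\exp\Bigl(\int_{0+}^\infty\ln(\lambda)\,dF(\lambda)\Bigr) \] if this integral is $>-\infty$, and $0$ otherwise. Let $d \ge 0$ and let $A\in GL_d(L^1(G))$ be an invertible matrix. For $i\in I$ let $A[i]\in GL_d(L^1(G/G_i))$ be the invertible matrix obtained by applying to each entry of $A$ the ring homomorphism $L^1(G)\to L^1(G/G_i)$ induced by the projection $G\to G/G_i$. Then the limit on the right-hand side exists and \[ {\det}_{\mathcal N(G)}^{(2)}\bigl(r_A^{(2)}\colon L^2(G)^d\to L^2(G)^d\bigr) =\lim_{i\in I}\,{\det}_{\mathcal N(G/G_i)}^{(2)}\bigl(r_{A[i]}^{(2)}\colon L^2(G/G_i)^d\to L^2(G/G_i)^d\bigr). \] -/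

import Mathlib

open Filter Topology MeasureTheory

universe u v

namespace L2Approx

/-! ### The group Banach algebra `L¹(G)` of a discrete group -/

/-- `L¹(G)`: formal sums `∑ λ_g · g` with complex coefficients such that `∑ |λ_g| < ∞`. -/
@[ext]
structure L1 (G : Type u) where
  /-- The coefficient function `g ↦ λ_g`. -/
  coeff : G → ℂ
  summable_norm : Summable fun g => ‖coeff g‖

namespace L1

section Additive

variable {G : Type u}

theorem summable (f : L1 G) : Summable f.coeff := f.summable_norm.of_norm

theorem bounded (f : L1 G) (g : G) : ‖f.coeff g‖ ≤ ∑' x, ‖f.coeff x‖ :=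
  f.summable_norm.le_tsum g fun _ _ => norm_nonneg _

noncomputable instance : Zero (L1 G) := ⟨⟨fun _ => 0, by simp⟩⟩

noncomputable instance : Add (L1 G) :=
  ⟨fun f h => ⟨fun g => f.coeff g + h.coeff g,
    .of_nonneg_of_le (fun _ => norm_nonneg _) (fun _ => norm_add_le _ _)
      (f.summable_norm.add h.summable_norm)⟩⟩

noncomputable instance : Neg (L1 G) :=
  ⟨fun f => ⟨fun g => -f.coeff g, by simpa using f.summable_norm⟩⟩

@[simp] theorem zero_coeff (g : G) : (0 : L1 G).coeff g = 0 := rfl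

@[simp] theorem add_coeff (f h : L1 G) (g : G) : (f + h).coeff g = f.coeff g + h.coeff g := rfl

@[simp] theorem neg_coeff (f : L1 G) (g : G) : (-f).coeff g = -f.coeff g := rfl

noncomputable instance : AddCommGroup (L1 G) where
  add_assoc _ _ _ := by ext; simp [add_assoc]
  zero_add _ := by ext; simp
  add_zero _ := by ext; simp
  nsmul := nsmulRec
  zsmul := zsmulRec
  neg_add_cancel _ := by ext; simp
  add_comm _ _ := by ext; simp [add_comm]

end Additive

section Multiplicative

variable {G : Type u} [Group G]

theorem summable_mul_aux (f h : L1 G) :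
    Summable fun p : G × G => ‖f.coeff p.1 * h.coeff (p.1⁻¹ * p.2)‖ := by
  have key : Summable fun p : G × G => ‖f.coeff p.1 * h.coeff p.2‖ :=
    f.summable_norm.mul_norm h.summable_norm
  let e : G × G ≃ G × G :=
    { toFun := fun p => (p.1, p.1⁻¹ * p.2)
      invFun := fun p => (p.1, p.1 * p.2)
      left_inv := fun p => by simp
      right_inv := fun p => by simp }
  exact e.summable_iff.mpr key

theorem summable_mul_snd (f h : L1 G) (x : G) :
    Summable fun y : G => f.coeff y * h.coeff (y⁻¹ * x) :=
  ((summable_mul_aux f h).prod_symm.prod_factor x).of_norm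

/-- Convolution, the extension of the multiplication of the group ring. -/
noncomputable instance : Mul (L1 G) :=
  ⟨fun f h => ⟨fun x => ∑' y, f.coeff y * h.coeff (y⁻¹ * x), by
    refine .of_nonneg_of_le (fun _ => norm_nonneg _) (fun x => norm_tsum_le_tsum_norm ?_)
      (summable_mul_aux f h).prod_symm.prod
    exact (summable_mul_aux f h).prod_symm.prod_factor x⟩⟩

theorem mul_coeff (f h : L1 G) (x : G) :
    (f * h).coeff x = ∑' y, f.coeff y * h.coeff (y⁻¹ * x) := rfl

open scoped Classical in
/-- The unit of `L¹(G)` is the unit element of `G`. -/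
noncomputable instance : One (L1 G) :=
  ⟨⟨Pi.single 1 1, (hasSum_single (1 : G) fun g hg => by simp [hg]).summable⟩⟩

open scoped Classical in
theorem one_coeff (g : G) : (1 : L1 G).coeff g = if g = 1 then 1 else 0 := by
  change (Pi.single 1 1 : G → ℂ) g = _
  rw [Pi.single_apply]

noncomputable instance : Ring (L1 G) where
  __ := (inferInstance : AddCommGroup (L1 G))
  left_distrib a b c := by
    ext x
    simp only [mul_coeff, add_coeff, mul_add]
    exact (summable_mul_snd a b x).tsum_add (summable_mul_snd a c x)
  right_distrib a b c := by
    ext x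
    simp only [mul_coeff, add_coeff, add_mul]
    exact (summable_mul_snd a c x).tsum_add (summable_mul_snd b c x)
  zero_mul a := by ext x; simp [mul_coeff]
  mul_zero a := by ext x; simp [mul_coeff]
  one_mul a := by
    ext x
    rw [mul_coeff, tsum_eq_single 1 fun y hy => by simp [one_coeff, hy]]
    simp [one_coeff]
  mul_one a := by
    ext x
    rw [mul_coeff, tsum_eq_single x fun y hy => ?_]
    · simp [one_coeff]
    · have : y⁻¹ * x ≠ 1 := fun h => hy (inv_mul_eq_one.mp h)
      simp [one_coeff, this]
  mul_assoc a b c := by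
    ext x
    have hs : Summable (Function.uncurry fun (w y : G) =>
        a.coeff y * b.coeff (y⁻¹ * w) * c.coeff (w⁻¹ * x)) := by
      refine Summable.of_norm_bounded
        ((summable_mul_aux a b).prod_symm.mul_right (∑' z, ‖c.coeff z‖)) fun p => ?_
      simp only [Function.uncurry, norm_mul, Prod.fst_swap, Prod.snd_swap]
      gcongr
      exact bounded c _
    simp only [mul_coeff]
    calc ∑' w, (∑' y, a.coeff y * b.coeff (y⁻¹ * w)) * c.coeff (w⁻¹ * x)
        = ∑' w, ∑' y, a.coeff y * b.coeff (y⁻¹ * w) * c.coeff (w⁻¹ * x) := by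
          simp only [tsum_mul_right]
      _ = ∑' y, ∑' w, a.coeff y * b.coeff (y⁻¹ * w) * c.coeff (w⁻¹ * x) := hs.tsum_comm.symm
      _ = ∑' y, a.coeff y * ∑' z, b.coeff z * c.coeff (z⁻¹ * (y⁻¹ * x)) := by
          refine tsum_congr fun y => ?_
          rw [← tsum_mul_left, ← (Equiv.mulLeft y).tsum_eq]
          refine tsum_congr fun z => ?_
          simp [mul_assoc]

end Multiplicative

section Map

variable {G : Type u} {H : Type v}

open scoped Classical in
theorem summable_map_aux (φ : G → H) (f : L1 G) :
    Summable fun p : G × H => ‖if φ p.1 = p.2 then f.coeff p.1 else 0‖ := by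
  have hinj : Function.Injective fun g : G => (g, φ g) := fun a b h => (Prod.ext_iff.mp h).1
  refine (hinj.summable_iff ?_).mp ?_
  · rintro ⟨g, h⟩ hp
    have : φ g ≠ h := fun e => hp ⟨g, by simp [e]⟩
    simp [this]
  · simpa [Function.comp_def] using f.summable_norm

open scoped Classical in
/-- The push-forward `∑ λ_g · g ↦ ∑ λ_g · φ(g)`: the coefficient at `h` is the sum of the `λ_g`
over all `g` with `φ g = h`. -/
noncomputable def pushforward (φ : G → H) (f : L1 G) : L1 H where
  coeff h := ∑' g, if φ g = h then f.coeff g else 0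
  summable_norm := by
    refine .of_nonneg_of_le (fun _ => norm_nonneg _) (fun x => norm_tsum_le_tsum_norm ?_)
      (summable_map_aux φ f).prod_symm.prod
    exact (summable_map_aux φ f).prod_symm.prod_factor x

open scoped Classical in
theorem pushforward_coeff (φ : G → H) (f : L1 G) (h : H) :
    (pushforward φ f).coeff h = ∑' g, if φ g = h then f.coeff g else 0 := rfl

open scoped Classical in
theorem summable_map_snd (φ : G → H) (f : L1 G) (h : H) :
    Summable fun g : G => if φ g = h then f.coeff g else 0 :=
  ((summable_map_aux φ f).prod_symm.prod_factor h).of_norm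

variable [Group G] [Group H]

open scoped Classical in
theorem pushforward_mul (φ : G →* H) (f k : L1 G) :
    pushforward φ (f * k) = pushforward φ f * pushforward φ k := by
  ext q
  have h1 : Summable (Function.uncurry fun (x y : G) =>
      if φ x = q then f.coeff y * k.coeff (y⁻¹ * x) else 0) := by
    refine Summable.of_norm_bounded (summable_mul_aux f k).prod_symm fun p => ?_
    by_cases hp : φ p.1 = q <;> simp [Function.uncurry, hp]
    positivity
  have h2 : Summable (Function.uncurry fun (p : H) (y : G) =>
      (if φ y = p then f.coeff y else 0) * (pushforward φ k).coeff (p⁻¹ * q)) := by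
    refine Summable.of_norm_bounded ((summable_map_aux φ f).prod_symm.mul_right
      (∑' z, ‖(pushforward φ k).coeff z‖)) fun p => ?_
    simp only [Function.uncurry, norm_mul, Prod.fst_swap, Prod.snd_swap]
    gcongr
    exact bounded _ _
  calc (pushforward φ (f * k)).coeff q
      = ∑' x, ∑' y, if φ x = q then f.coeff y * k.coeff (y⁻¹ * x) else 0 := by
        rw [pushforward_coeff]
        refine tsum_congr fun x => ?_
        by_cases hx : φ x = q <;> simp [hx, mul_coeff]
    _ = ∑' y, ∑' x, if φ x = q then f.coeff y * k.coeff (y⁻¹ * x) else 0 := h1.tsum_comm.symm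
    _ = ∑' y, f.coeff y * (pushforward φ k).coeff ((φ y)⁻¹ * q) := by
        refine tsum_congr fun y => ?_
        rw [pushforward_coeff, ← tsum_mul_left, ← (Equiv.mulLeft y).tsum_eq]
        refine tsum_congr fun z => ?_
        simp [eq_inv_mul_iff_mul_eq]
    _ = ∑' y, ∑' p, (if φ y = p then f.coeff y else 0) *
          (pushforward φ k).coeff (p⁻¹ * q) := by
        refine tsum_congr fun y => ?_
        rw [tsum_eq_single (φ y) fun p hp => by simp [Ne.symm hp]]
        simp
    _ = ∑' p, ∑' y, (if φ y = p then f.coeff y else 0) *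
          (pushforward φ k).coeff (p⁻¹ * q) := h2.tsum_comm
    _ = (pushforward φ f * pushforward φ k).coeff q := by
        simp only [mul_coeff, pushforward_coeff φ f, tsum_mul_right]

/-- The ring homomorphism `L¹(G) → L¹(H)` induced by a group homomorphism `φ : G → H`. -/
noncomputable def map (φ : G →* H) : L1 G →+* L1 H where
  toFun := pushforward φ
  map_zero' := by ext; simp [pushforward_coeff]
  map_add' f k := by
    classical
    ext q
    simp only [pushforward_coeff, add_coeff]
    rw [← (summable_map_snd φ f q).tsum_add (summable_map_snd φ k q)]
    refine tsum_congr fun g => ?_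
    split_ifs <;> simp
  map_one' := by
    classical
    ext q
    rw [pushforward_coeff, tsum_eq_single 1 fun g hg => by simp [one_coeff, hg]]
    simp [one_coeff, eq_comm]
  map_mul' := pushforward_mul φ

end Map

end L1

/-! ### The Hilbert modules `L²(G)^d` and right multiplication -/

/-- `L²(G)` for a discrete group `G`. -/
abbrev L2 (G : Type u) : Type u := lp (fun _ : G => ℂ) 2

/-- The Hilbert space direct sum `L²(G)^d`. -/
abbrev L2Pow (G : Type u) (d : ℕ) : Type u := PiLp 2 fun _ : Fin d => L2 G

section RightMultiplication

variable {G : Type u} [Group G]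

theorem memℓp_translate (h : G) (x : L2 G) : Memℓp (fun g : G => x (g * h⁻¹)) 2 := by
  have hx := (memℓp_gen_iff (p := 2) (by simp)).mp (lp.memℓp x)
  exact (memℓp_gen_iff (by simp)).mpr ((Equiv.mulRight h⁻¹).summable_iff.mpr hx)

/-- Right multiplication with a group element `h` on `L²(G)`:
`∑ x_g · g ↦ ∑ x_g · gh = ∑ x_{gh⁻¹} · g`. -/
noncomputable def rightTranslation (h : G) : L2 G →ₗᵢ[ℂ] L2 G where
  toFun x := ⟨fun g => x (g * h⁻¹), memℓp_translate h x⟩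
  map_add' _ _ := rfl
  map_smul' _ _ := rfl
  norm_map' x := by
    rw [lp.norm_eq_tsum_rpow (by simp), lp.norm_eq_tsum_rpow (by simp)]
    congr 1
    exact (Equiv.mulRight h⁻¹).tsum_eq fun g => ‖x g‖ ^ (2 : ENNReal).toReal

@[simp] theorem rightTranslation_apply (h g : G) (x : L2 G) :
    rightTranslation h x g = x (g * h⁻¹) := rfl

/-- Right multiplication `x ↦ x · a` with `a = ∑ λ_h · h ∈ L¹(G)` on `L²(G)`, i.e. the sum
`∑ λ_h · (right multiplication with h)`, which converges absolutely in operator norm. -/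
noncomputable def rightMul (a : L1 G) : L2 G →L[ℂ] L2 G :=
  ∑' h, a.coeff h • (rightTranslation h).toContinuousLinearMap

theorem summable_rightMul (a : L1 G) :
    Summable fun h => a.coeff h • (rightTranslation h).toContinuousLinearMap := by
  refine Summable.of_norm_bounded a.summable_norm fun h => ?_
  rw [norm_smul]
  exact mul_le_of_le_one_right (norm_nonneg _)
    (LinearIsometry.norm_toContinuousLinearMap_le _)

/-- Right multiplication is given by convolution. -/
theorem rightMul_apply (a : L1 G) (x : L2 G) (g : G) :
    rightMul a x g = ∑' h, x (g * h⁻¹) * a.coeff h := by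
  let ev : (L2 G →L[ℂ] L2 G) →L[ℂ] ℂ :=
    (lp.evalCLM ℂ (fun _ : G => ℂ) 2 g) ∘L ContinuousLinearMap.apply ℂ (L2 G) x
  have h := ev.map_tsum (summable_rightMul a)
  refine Eq.trans h (tsum_congr fun k => ?_)
  change a.coeff k * x (g * k⁻¹) = _
  ring

/-- `r_A^{(2)} : L²(G)^r → L²(G)^s`, right multiplication of row vectors with the
`(r,s)`-matrix `A` over `L¹(G)`: `(xA)_j = ∑ i, x_i · A_{ij}`. -/
noncomputable def rightMulMatrix {r s : ℕ} (A : Matrix (Fin r) (Fin s) (L1 G)) :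
    L2Pow G r →L[ℂ] L2Pow G s :=
  (PiLp.continuousLinearEquiv 2 ℂ fun _ : Fin s => L2 G).symm.toContinuousLinearMap ∘L
    ContinuousLinearMap.pi fun j =>
      ∑ i, rightMul (A i j) ∘L PiLp.proj 2 (fun _ : Fin r => L2 G) i

theorem rightMulMatrix_apply {r s : ℕ} (A : Matrix (Fin r) (Fin s) (L1 G)) (x : L2Pow G r)
    (j : Fin s) : rightMulMatrix A x j = ∑ i, rightMul (A i j) (x i) := by
  simp [rightMulMatrix]

/-- `r_A^{(2)}` commutes with the left `G`-actions: if `y = k · x`, i.e. `y_i(g) = x_i(k⁻¹g)`,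
then `r_A^{(2)}(y) = k · r_A^{(2)}(x)`. -/
theorem rightMulMatrix_equivariant {r s : ℕ} (A : Matrix (Fin r) (Fin s) (L1 G)) (k : G)
    (x y : L2Pow G r) (hy : ∀ i g, y i g = x i (k⁻¹ * g)) (j : Fin s) (g : G) :
    rightMulMatrix A y j g = rightMulMatrix A x j (k⁻¹ * g) := by
  simp only [rightMulMatrix_apply, lp.coeFn_sum, Finset.sum_apply, rightMul_apply, hy, mul_assoc]

end RightMultiplication

/-! ### Spectral projections and absolute values of operators on Hilbert spaces -/

section Spectral

variable {E F : Type*} [NormedAddCommGroup E] [InnerProductSpace ℂ E] [CompleteSpace E]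
  [NormedAddCommGroup F] [InnerProductSpace ℂ F] [CompleteSpace F]

/-- The spectral projection `E_t = χ_{(-∞, t]}(T)` of a self-adjoint bounded operator `T`:
the orthogonal projection onto the kernel of the positive part `(T - t)₊`. -/
noncomputable def spectralProjection (T : E →L[ℂ] E) (t : ℝ) : E →L[ℂ] E :=
  (cfc (fun x : ℝ => max (x - t) 0) T).ker.starProjection

/-- `|f| = (f* f)^{1/2}` for a bounded operator `f`. -/
noncomputable def absOperator (f : E →L[ℂ] F) : E →L[ℂ] E :=
  CFC.sqrt (ContinuousLinearMap.adjoint f ∘L f)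

theorem isSelfAdjoint_absOperator (f : E →L[ℂ] F) : IsSelfAdjoint (absOperator f) :=
  .of_nonneg (CFC.sqrt_nonneg _)

theorem spectralProjection_mono (T : E →L[ℂ] E) (hT : IsSelfAdjoint T) {a b : ℝ}
    (hab : a ≤ b) : spectralProjection T a ≤ spectralProjection T b := by
  rcases hab.eq_or_lt with rfl | hlt
  · exact le_rfl
  refine Submodule.starProjection_le_starProjection_iff.mpr ?_
  have hpos : ∀ x : ℝ, 0 < max (x - a) (b - a) := fun x => lt_max_of_lt_right (sub_pos.mpr hlt)
  have hfac : (fun x : ℝ => max (x - b) 0) =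
      fun x => (max (x - b) 0 / max (x - a) (b - a)) * max (x - a) 0 := by
    funext x
    rcases le_or_gt x b with hx | hx
    · rw [max_eq_right (by linarith)]; simp
    · rw [max_eq_left (by linarith : (0 : ℝ) ≤ x - b),
        max_eq_left (by linarith : b - a ≤ x - a), max_eq_left (by linarith : (0 : ℝ) ≤ x - a)]
      have : x - a ≠ 0 := by linarith
      field_simp
  have hc : Continuous fun x : ℝ => max (x - b) 0 / max (x - a) (b - a) :=
    Continuous.div (by fun_prop) (by fun_prop) fun x => (hpos x).ne'
  have := hT
  intro v hv
  have hv' : cfc (fun x : ℝ => max (x - a) 0) T v = 0 := hv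
  change cfc (fun x : ℝ => max (x - b) 0) T v = 0
  rw [hfac, cfc_mul _ _ T hc.continuousOn (by fun_prop), mul_apply_eq_comp, hv',
    map_zero]

end Spectral

/-! ### The Fuglede–Kadison determinant -/

section Determinant

variable {G : Type u} [Group G] {r s d : ℕ}

/-- The vector of `L²(G)^d` whose `i`-th component is the unit element of `G` and whose other
components vanish. -/
noncomputable def unitVector (G : Type u) [Group G] (d : ℕ) (i : Fin d) : L2Pow G d := by
  classical exact WithLp.toLp 2 (Pi.single i (lp.single 2 (1 : G) (1 : ℂ)))

/-- The von Neumann trace `tr_{𝒩(G)}(T) = ∑ i, ⟨T e_i, e_i⟩` of a (`G`-equivariant) bounded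
operator `T` on `L²(G)^d`. -/
noncomputable def vnTrace (T : L2Pow G d →L[ℂ] L2Pow G d) : ℂ :=
  ∑ i, inner ℂ (unitVector G d i) (T (unitVector G d i))

/-- The spectral density function `F(t) = tr_{𝒩(G)}(E_t)`, where `(E_t)` is the spectral family
of `|f|` (equivalently, `E_t` is the spectral projection of `f* f` for `[0, t²]` if `t ≥ 0`). -/
noncomputable def spectralDensity (f : L2Pow G r →L[ℂ] L2Pow G s) (t : ℝ) : ℝ :=
  (vnTrace (spectralProjection (absOperator f) t)).re

theorem spectralDensity_mono (f : L2Pow G r →L[ℂ] L2Pow G s) : Monotone (spectralDensity f) := by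
  intro a b hab
  have hle := spectralProjection_mono _ (isSelfAdjoint_absOperator f) hab
  simp only [spectralDensity, vnTrace, Complex.re_sum]
  refine Finset.sum_le_sum fun i _ => ?_
  have h := ((ContinuousLinearMap.le_def _ _).mp hle).re_inner_nonneg_right (unitVector G r i)
  rw [sub_apply, inner_sub_right, map_sub] at h
  exact sub_nonneg.mp h

/-- The Fuglede–Kadison determinant over `𝒩(G)` of a morphism `f : L²(G)^r → L²(G)^s` of Hilbert
`𝒩(G)`-modules (a bounded operator that commutes with the left `G`-actions) with spectral density function `F`: it is `exp (∫_{0+}^∞ ln(t) dF(t))` if this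
Stieltjes integral is not `-∞`, and `0` otherwise. Since `F` is bounded, and constant on
`[‖f‖, ∞)`, the integral is not `-∞` exactly if `ln` is integrable on `(0, ∞)`
with respect to `dF`. -/
noncomputable def fugledeKadisonDet (f : L2Pow G r →L[ℂ] L2Pow G s) : ℝ := by
  classical exact
    if IntegrableOn Real.log (Set.Ioi 0) (spectralDensity_mono f).stieltjesFunction.measure then
      Real.exp (∫ t in Set.Ioi (0 : ℝ), Real.log t
        ∂(spectralDensity_mono f).stieltjesFunction.measure)
    else 0

end Determinant

end L2Approx

/-!
The spectrum of an invertible operator `|f|` stays away from `0`, so `log det f = tr(log |f|)`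
involves only continuous functions of `|f|`, and `log` can be replaced by polynomials.

Let `K` bound the sums of the `ℓ¹`-norms of the entries of `A` and of its inverse. Push-forward
along `G → G/G_i` does not increase `ℓ¹`-norms, so `K` serves for all `A[i]` as well, and the
spectra of `|r_A|` and of all `|r_{A[i]}|` lie in `[K⁻¹, K]` (`spectrum_absOperator_subset`). By the
Weierstrass theorem there is a polynomial `q` such that `q(x²)` is uniformly close to `log x` on
this interval; then `log det` is close to `tr(q(f* f))`, with an error that does not depend on `i`
(`exists_fugledeKadisonDet_eq_exp`). Since `f* f` is right multiplication with `A A^*`, its moments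
`tr((f* f)^n)` are the sums of the coefficients at the unit element of the diagonal entries of
`(A A^*)^n`. Over `G/G_i` such a coefficient is the sum of the coefficients over `G_i`, and it
converges to the coefficient at the unit element of `G` because the `G_i` shrink to the trivial
subgroup (`L1.tendsto_map_mk_coeff_one`). Hence `log det r_{A[i]}` converges to
`log det r_A`.

To relate the determinant, which is defined by spectral projections, to the continuous functional
calculus, the trace is represented by a measure `μ` on the spectrum via the Riesz–Markov–Kakutani
theorem (`exists_spectralMeasure`). Approximating the indicator function of `(-∞, t]` by continuous
functions (`tendsto_cfc_iicApprox`) shows that the spectral density at `t` is `μ (-∞, t]`, so that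
`μ` is the Stieltjes measure of the spectral density function
(`integral_stieltjes_spectralProjection`).
-/

namespace L2Approx

/-! ### Spectral measures of self-adjoint operators -/

section SpectralMeasure

variable {E : Type*} [NormedAddCommGroup E] [InnerProductSpace ℂ E] [CompleteSpace E]

/-- A positive functional on the bounded operators, composed with the continuous functional calculus
of a self-adjoint operator `T`, is integration against a finite measure on the spectrum of `T`
(the Riesz–Markov–Kakutani theorem). -/
theorem exists_spectralMeasure (φ : (E →L[ℂ] E) →ₗ[ℝ] ℝ) (hφ : ∀ S, 0 ≤ S → 0 ≤ φ S)
    (T : E →L[ℂ] E) (hT : IsSelfAdjoint T) :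
    ∃ μ : Measure ℝ, IsFiniteMeasure μ ∧ μ (spectrum ℝ T)ᶜ = 0 ∧
      ∀ g : ℝ → ℝ, ContinuousOn g (spectrum ℝ T) → ∫ x, g x ∂μ = φ (cfc g T) := by
  have : CompactSpace (spectrum ℝ T) :=
    isCompact_iff_compactSpace.mp (ContinuousFunctionalCalculus.isCompact_spectrum T)
  let Λ : CompactlySupportedContinuousMap (spectrum ℝ T) ℝ →ₚ[ℝ] ℝ :=
    PositiveLinearMap.mk₀
      { toFun := fun g => φ (cfcHom hT g.toContinuousMap)
        map_add' := fun g h => by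
          rw [← map_add, ← map_add]; rfl
        map_smul' := fun c g => by
          rw [RingHom.id_apply, ← map_smul, ← map_smul]; rfl }
      (fun g hg => hφ _ (cfcHom_nonneg_iff hT |>.mpr hg))
  have hfin : IsFiniteMeasure (RealRMK.rieszMeasure Λ) :=
    ⟨isCompact_univ.measure_lt_top⟩
  refine ⟨(RealRMK.rieszMeasure Λ).map Subtype.val, inferInstance, ?_, fun g hg => ?_⟩
  · rw [Measure.map_apply measurable_subtype_coe
      (ContinuousFunctionalCalculus.isCompact_spectrum T).measurableSet.compl]
    simp
  · rw [(MeasurableEmbedding.subtype_coe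
      (ContinuousFunctionalCalculus.isCompact_spectrum T).measurableSet).integral_map,
      cfc_apply g T hT hg]
    exact RealRMK.integral_rieszMeasure Λ
      (CompactlySupportedContinuousMap.continuousMapEquiv
        ⟨(spectrum ℝ T).domRestrict g, hg.domRestrict⟩)

/-- A continuous approximation of the indicator function of `(-∞, t]`: it is `1` on `(-∞, t]`,
`0` on `[t + 1 / (n + 1), ∞)`, and affine in between. -/
noncomputable def iicApprox (t : ℝ) (n : ℕ) (x : ℝ) : ℝ := max (1 - (n + 1) * max (x - t) 0) 0

theorem continuous_iicApprox (t : ℝ) (n : ℕ) : Continuous (iicApprox t n) := by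
  unfold iicApprox; fun_prop

theorem abs_iicApprox_le (t : ℝ) (n : ℕ) (x : ℝ) : |iicApprox t n x| ≤ 1 := by
  unfold iicApprox
  rw [abs_of_nonneg (le_max_right _ _)]
  have : 0 ≤ ((n : ℝ) + 1) * max (x - t) 0 := by positivity
  exact max_le (by linarith) zero_le_one

theorem tendsto_iicApprox (t x : ℝ) :
    Tendsto (fun n => iicApprox t n x) atTop (𝓝 ((Set.Iic t).indicator 1 x)) := by
  rcases le_or_gt x t with h | h
  · rw [Set.indicator_of_mem (Set.mem_Iic.mpr h)]
    refine tendsto_const_nhds.congr fun n => ?_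
    simp [iicApprox, max_eq_right (sub_nonpos.mpr h)]
  · rw [Set.indicator_of_notMem (by simpa using h)]
    obtain ⟨m, hm⟩ := exists_nat_gt (1 / (x - t))
    have hx : 0 < x - t := sub_pos.mpr h
    refine tendsto_const_nhds.congr' ?_
    filter_upwards [eventually_ge_atTop m] with n hn
    have : 1 ≤ ((n : ℝ) + 1) * (x - t) := by
      rw [div_lt_iff₀ hx] at hm
      refine hm.le.trans ?_
      gcongr
      exact (Nat.cast_le.mpr hn).trans (by linarith)
    rw [iicApprox, max_eq_left hx.le, max_eq_right (by linarith)]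

theorem abs_iicApprox_mul_le (t : ℝ) (n : ℕ) (x : ℝ) :
    |iicApprox t n x * max (x - t) 0| ≤ 1 / (n + 1) := by
  have hy0 : 0 ≤ max (x - t) 0 := le_max_right _ _
  rw [iicApprox, abs_of_nonneg (mul_nonneg (le_max_right _ _) hy0),
    le_div_iff₀ (by positivity)]
  generalize max (x - t) 0 = y at hy0
  rcases le_total (1 - ((n : ℝ) + 1) * y) 0 with h | h
  · simp [max_eq_right h]
  · rw [max_eq_left h]
    have : 0 ≤ ((n : ℝ) + 1) * y := by positivity
    nlinarith [sq_nonneg (((n : ℝ) + 1) * y)]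

/-- The difference of `iicApprox t n` and `1` is a continuous multiple of `max (x - t) 0`; the
denominator is bounded below by `1`. -/
theorem iicApprox_eq (t : ℝ) (n : ℕ) (x : ℝ) :
    iicApprox t n x =
      1 - (n + 1) / max ((n + 1) * max (x - t) 0) 1 * max (x - t) 0 := by
  rw [iicApprox]
  generalize max (x - t) 0 = y
  have hn : (0 : ℝ) < n + 1 := by positivity
  rcases le_total (((n : ℝ) + 1) * y) 1 with h | h
  · rw [max_eq_right h, max_eq_left (by linarith), div_one]
  · rw [max_eq_left h, max_eq_right (by linarith)]
    have : y ≠ 0 := by rintro rfl; norm_num at h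
    field_simp
    ring

/-- For `n → ∞` the operators `gₙ(T)`, where `gₙ` decreases to the indicator function of
`(-∞, t]`, converge strongly to the spectral projection: `gₙ(T)` is the identity on the kernel of
`(T - t)₊`, and `gₙ(T) (T - t)₊` tends to `0` in norm. -/
theorem tendsto_cfc_iicApprox (T : E →L[ℂ] E) (hT : IsSelfAdjoint T) (t : ℝ) (v : E) :
    Tendsto (fun n => cfc (iicApprox t n) T v) atTop (𝓝 (spectralProjection T t v)) := by
  set C : E →L[ℂ] E := cfc (fun x : ℝ => max (x - t) 0) T with hC
  have hCsa : IsSelfAdjoint C := cfc_predicate _ _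
  have hP : spectralProjection T t = C.ker.starProjection := rfl
  -- `gₙ(T)` is the identity on the kernel of `C = (T - t)₊`.
  have hker : ∀ u, C u = 0 → ∀ n, cfc (iicApprox t n) T u = u := fun u hu n => by
    have hc : Continuous fun x : ℝ => ((n : ℝ) + 1) / max ((n + 1) * max (x - t) 0) 1 :=
      Continuous.div (by fun_prop) (by fun_prop)
        fun x => (lt_max_of_lt_right one_pos).ne'
    rw [funext (iicApprox_eq t n), cfc_sub (fun _ => 1) _ T (by fun_prop)
      (by exact (hc.mul (by fun_prop)).continuousOn),
      cfc_mul _ _ T hc.continuousOn (by fun_prop), cfc_const_one ℝ T]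
    simp [← hC, hu]
  have hnorm : ∀ n, ‖cfc (iicApprox t n) T‖ ≤ 1 := fun n =>
    norm_cfc_le zero_le_one fun x _ => abs_iicApprox_le t n x
  -- On the orthogonal complement, the closure of the range of `C`, `gₙ(T)` tends to `0` strongly.
  have hran : ∀ w ∈ C.kerᗮ, Tendsto (fun n => cfc (iicApprox t n) T w) atTop (𝓝 0) := by
    intro w hw
    have hw' : w ∈ C.range.topologicalClosure := by
      rwa [ContinuousLinearMap.orthogonal_ker, ← ContinuousLinearMap.star_eq_adjoint,
        hCsa.star_eq] at hw
    rw [Metric.tendsto_atTop]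
    intro ε hε
    obtain ⟨_, ⟨u, rfl⟩, hu⟩ := Metric.mem_closure_iff.mp hw' (ε / 2) (by positivity)
    obtain ⟨m, hm⟩ := exists_nat_gt (‖u‖ / (ε / 2))
    refine ⟨m, fun n hn => ?_⟩
    have h1 : cfc (iicApprox t n) T (C u) =
        cfc (fun x => iicApprox t n x * max (x - t) 0) T u := by
      rw [cfc_mul _ _ T (continuous_iicApprox t n).continuousOn (by fun_prop)]
      rfl
    have h2 : ‖cfc (iicApprox t n) T (C u)‖ < ε / 2 := by
      rw [h1]
      refine (ContinuousLinearMap.le_of_opNorm_le _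
        (norm_cfc_le (c := 1 / ((n : ℝ) + 1)) (by positivity)
          fun x _ => abs_iicApprox_mul_le t n x) u).trans_lt ?_
      rw [div_lt_iff₀ (by positivity)] at hm
      rw [div_mul_eq_mul_div, one_mul, div_lt_iff₀ (by positivity), mul_comm]
      refine hm.trans ?_
      gcongr
      exact (Nat.cast_le.mpr hn).trans_lt (by linarith)
    have h3 : ‖cfc (iicApprox t n) T (w - C u)‖ < ε / 2 := by
      refine (ContinuousLinearMap.le_of_opNorm_le _ (hnorm n) _).trans_lt ?_
      rw [one_mul, ← dist_eq_norm]
      exact hu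
    rw [dist_zero_right, ← sub_add_cancel w (C u), map_add]
    exact (norm_add_le _ _).trans_lt (by linarith)
  have h0 := hran _ (C.ker.sub_starProjection_mem_orthogonal v)
  have h1 := h0.add_const (spectralProjection T t v)
  rw [zero_add] at h1
  refine h1.congr fun n => ?_
  rw [map_sub, hP, hker _ (C.ker.starProjection_apply_mem v) n, sub_add_cancel]

end SpectralMeasure

/-- The distribution function of a finite measure is right continuous, so passing to right limits
in the Stieltjes measure does not change it. -/
theorem stieltjes_measure_eq {F : ℝ → ℝ} (hF : Monotone F) (μ : Measure ℝ) [IsFiniteMeasure μ]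
    (h : ∀ t, F t = μ.real (Set.Iic t)) : hF.stieltjesFunction.measure = μ := by
  have hr : ∀ t, hF.stieltjesFunction t = F t := fun t => by
    rw [hF.stieltjesFunction_eq]
    refine rightLim_eq_of_tendsto ?_
    have h1 := tendsto_measure_biInter_gt (μ := μ) (s := Set.Iic) (a := t)
      (fun r _ => measurableSet_Iic.nullMeasurableSet)
      (fun i j _ hij => Set.Iic_subset_Iic.mpr hij)
      ⟨t + 1, by simp, measure_ne_top _ _⟩
    have h2 : ⋂ r > t, Set.Iic r = Set.Iic t := by
      ext x; simpa using ⟨fun h => le_of_forall_gt_imp_ge_of_dense h, fun h r hr => h.trans hr.le⟩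
    rw [h2] at h1
    rw [h t, show F = fun r => μ.real (Set.Iic r) from funext h]
    exact (ENNReal.tendsto_toReal (measure_ne_top _ _)).comp h1
  refine Measure.ext_of_Ioc _ _ fun a b hab => ?_
  have hd : Set.Ioc a b = Set.Iic b \ Set.Iic a := by ext x; simp [and_comm]
  rw [StieltjesFunction.measure_Ioc, hr, hr, h, h, hd,
    ← measureReal_sdiff (Set.Iic_subset_Iic.mpr hab.le) measurableSet_Iic]
  exact ofReal_measureReal

/-! ### Traces given by finitely many vectors -/

section VectorTrace

variable {E F ι : Type*} [NormedAddCommGroup E] [InnerProductSpace ℂ E] [CompleteSpace E]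
  [NormedAddCommGroup F] [InnerProductSpace ℂ F] [CompleteSpace F] [Fintype ι]

/-- The positive functional `T ↦ ∑ i, Re ⟨T e_i, e_i⟩` given by a finite family of vectors. -/
noncomputable def reTrace (e : ι → E) : (E →L[ℂ] E) →ₗ[ℝ] ℝ where
  toFun T := (∑ i, inner ℂ (e i) (T (e i))).re
  map_add' S T := by simp [Finset.sum_add_distrib]
  map_smul' c T := by
    simp [Finset.mul_sum, inner_smul_right_eq_smul]

omit [CompleteSpace E] in
theorem reTrace_apply (e : ι → E) (T : E →L[ℂ] E) :
    reTrace e T = (∑ i, inner ℂ (e i) (T (e i))).re := rfl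

omit [CompleteSpace E] in
theorem reTrace_nonneg (e : ι → E) (T : E →L[ℂ] E) (hT : 0 ≤ T) : 0 ≤ reTrace e T := by
  rw [reTrace_apply, Complex.re_sum]
  exact Finset.sum_nonneg fun i _ =>
    ((ContinuousLinearMap.nonneg_iff_isPositive T).mp hT).re_inner_nonneg_right _

omit [CompleteSpace E] in
theorem reTrace_one (e : ι → E) : reTrace e 1 = ∑ i, ‖e i‖ ^ 2 := by
  rw [reTrace_apply, Complex.re_sum]
  exact Finset.sum_congr rfl fun i _ => inner_self_eq_norm_sq (𝕜 := ℂ) (e i)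

omit [CompleteSpace E] in
theorem tendsto_reTrace (e : ι → E) {S : ℕ → E →L[ℂ] E} {T : E →L[ℂ] E}
    (h : ∀ v, Tendsto (fun n => S n v) atTop (𝓝 (T v))) :
    Tendsto (fun n => reTrace e (S n)) atTop (𝓝 (reTrace e T)) := by
  simp only [reTrace_apply]
  exact (Complex.continuous_re.tendsto _).comp
    (tendsto_finsetSum _ fun i _ => tendsto_const_nhds.inner (h _))

/-- The Stieltjes measure of the spectral density function `t ↦ tr(E_t)` of a self-adjoint operator
represents the trace of its continuous functional calculus. -/
theorem integral_stieltjes_spectralProjection (e : ι → E) (T : E →L[ℂ] E) (hT : IsSelfAdjoint T)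
    (hF : Monotone fun t => reTrace e (spectralProjection T t)) :
    IsFiniteMeasure hF.stieltjesFunction.measure ∧
    hF.stieltjesFunction.measure (spectrum ℝ T)ᶜ = 0 ∧
    ∀ g : ℝ → ℝ, ContinuousOn g (spectrum ℝ T) →
      ∫ x, g x ∂hF.stieltjesFunction.measure = reTrace e (cfc g T) := by
  obtain ⟨μ, hμ, hspec, hint⟩ := exists_spectralMeasure (reTrace e) (reTrace_nonneg e) T hT
  suffices h : ∀ t, reTrace e (spectralProjection T t) = μ.real (Set.Iic t) by
    rw [stieltjes_measure_eq hF μ h]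
    exact ⟨hμ, hspec, hint⟩
  intro t
  have h1 := tendsto_reTrace e (tendsto_cfc_iicApprox T hT t)
  have h2 : Tendsto (fun n => ∫ x, iicApprox t n x ∂μ) atTop
      (𝓝 (∫ x, (Set.Iic t).indicator 1 x ∂μ)) :=
    tendsto_integral_of_dominated_convergence (fun _ => 1)
      (fun n => (continuous_iicApprox t n).aestronglyMeasurable) (integrable_const _)
      (fun n => .of_forall fun x => abs_iicApprox_le t n x)
      (.of_forall fun x => tendsto_iicApprox t x)
  rw [integral_indicator_one measurableSet_Iic] at h2
  refine tendsto_nhds_unique (h1.congr fun n => ?_) h2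
  exact (hint _ (continuous_iicApprox t n).continuousOn).symm

/-- The spectrum of `|f|` lies in `[c, C]` if `c ‖v‖ ≤ ‖f v‖ ≤ C ‖v‖` for all `v`. -/
theorem spectrum_absOperator_subset (f : E →L[ℂ] F) {c C : ℝ} (hc : 0 ≤ c) (hC : 0 ≤ C)
    (hcf : ∀ v, c * ‖v‖ ≤ ‖f v‖) (hCf : ∀ v, ‖f v‖ ≤ C * ‖v‖) :
    spectrum ℝ (absOperator f) ⊆ Set.Icc c C := by
  intro x hx
  have hpos : 0 ≤ ContinuousLinearMap.adjoint f ∘L f :=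
    (ContinuousLinearMap.nonneg_iff_isPositive _).mpr f.isPositive_adjoint_comp_self
  have hx0 : 0 ≤ x := spectrum_nonneg_of_nonneg (CFC.sqrt_nonneg _) hx
  have hx2 := spectrum.pow_mem_pow _ 2 hx
  rw [sq (absOperator f), absOperator, CFC.sqrt_mul_sqrt_self _ hpos] at hx2
  have hre : ∀ (r : ℝ) (v : E), RCLike.re (inner ℂ ((algebraMap ℝ (E →L[ℂ] E) r) v) v) =
      r * ‖v‖ ^ 2 := fun r v => by
    rw [Algebra.algebraMap_eq_smul_one]
    change RCLike.re (inner ℂ (r • v) v) = _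
    rw [inner_smul_left_eq_smul, RCLike.smul_re, inner_self_eq_norm_sq]
  have hre' : ∀ v : E, RCLike.re (inner ℂ ((ContinuousLinearMap.adjoint f ∘L f) v) v) =
      ‖f v‖ ^ 2 := fun v => (f.apply_norm_sq_eq_inner_adjoint_left v).symm
  have hsym : ∀ r : ℝ, IsSelfAdjoint (algebraMap ℝ (E →L[ℂ] E) r) := fun r =>
    IsSelfAdjoint.algebraMap _ (.all r)
  -- `c ^ 2 ≤ f* f ≤ C ^ 2`, which bounds the spectrum of `|f| ^ 2 = f* f`.
  have h1 : algebraMap ℝ (E →L[ℂ] E) (c ^ 2) ≤ ContinuousLinearMap.adjoint f ∘L f := by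
    rw [ContinuousLinearMap.le_def, ContinuousLinearMap.isPositive_def']
    refine ⟨(IsSelfAdjoint.of_nonneg hpos).sub (hsym _), fun v => ?_⟩
    rw [ContinuousLinearMap.reApplyInnerSelf_apply, sub_apply, inner_sub_left, map_sub, hre, hre',
      sub_nonneg, ← mul_pow]
    exact pow_le_pow_left₀ (by positivity) (hcf v) 2
  have h2 : ContinuousLinearMap.adjoint f ∘L f ≤ algebraMap ℝ (E →L[ℂ] E) (C ^ 2) := by
    rw [ContinuousLinearMap.le_def, ContinuousLinearMap.isPositive_def']
    refine ⟨(hsym _).sub (IsSelfAdjoint.of_nonneg hpos), fun v => ?_⟩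
    rw [ContinuousLinearMap.reApplyInnerSelf_apply, sub_apply, inner_sub_left, map_sub, hre, hre',
      sub_nonneg, ← mul_pow]
    exact pow_le_pow_left₀ (by positivity) (hCf v) 2
  rw [algebraMap_le_iff_le_spectrum (IsSelfAdjoint.of_nonneg hpos)] at h1
  rw [le_algebraMap_iff_spectrum_le (IsSelfAdjoint.of_nonneg hpos)] at h2
  exact ⟨(pow_le_pow_iff_left₀ hc hx0 two_ne_zero).mp (h1 _ hx2),
    (pow_le_pow_iff_left₀ hx0 hC two_ne_zero).mp (h2 _ hx2)⟩

/-- If `q(x²)` approximates `log x` on an interval `[c, C]` of positive numbers that contains the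
spectrum of `|f|`, then `tr(q(f* f))` approximates `∫ log dF`. -/
theorem abs_integral_log_sub_le (e : ι → E) (f : E →L[ℂ] F) {c C : ℝ} (hc : 0 < c) (hC : 0 ≤ C)
    (hcf : ∀ v, c * ‖v‖ ≤ ‖f v‖) (hCf : ∀ v, ‖f v‖ ≤ C * ‖v‖)
    (hF : Monotone fun t => reTrace e (spectralProjection (absOperator f) t)) :
    IntegrableOn Real.log (Set.Ioi 0) hF.stieltjesFunction.measure ∧
    ∀ (q : Polynomial ℝ) (ε : ℝ), (∀ x ∈ Set.Icc c C, |q.eval (x ^ 2) - Real.log x| ≤ ε) →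
      |∫ x in Set.Ioi 0, Real.log x ∂hF.stieltjesFunction.measure -
        q.sum fun n a => a * reTrace e ((ContinuousLinearMap.adjoint f ∘L f) ^ n)| ≤
        ε * ∑ i, ‖e i‖ ^ 2 := by
  have hsa := isSelfAdjoint_absOperator f
  obtain ⟨hfin, hspec, hint⟩ := integral_stieltjes_spectralProjection e _ hsa hF
  set μ := hF.stieltjesFunction.measure
  have hsub := spectrum_absOperator_subset f hc.le hC hcf hCf
  have hmem : ∀ᵐ x ∂μ, x ∈ Set.Icc c C := by
    have : ∀ᵐ x ∂μ, x ∈ spectrum ℝ (absOperator f) := hspec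
    exact this.mono fun x hx => hsub hx
  have hres : μ.restrict (Set.Ioi 0) = μ :=
    Measure.restrict_eq_self_of_ae_mem (hmem.mono fun x hx => hc.trans_le hx.1)
  have hbdd : ∀ g : ℝ → ℝ, ContinuousOn g (Set.Icc c C) → Integrable g μ := fun g hg => by
    rw [← Measure.restrict_eq_self_of_ae_mem hmem]
    exact hg.integrableOn_compact isCompact_Icc
  have hlog : ContinuousOn Real.log (Set.Icc c C) :=
    Real.continuousOn_log.mono fun x hx => (hc.trans_le hx.1).ne'
  refine ⟨by rw [IntegrableOn, hres]; exact hbdd _ hlog, fun q ε hq => ?_⟩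
  have hpos : 0 ≤ ContinuousLinearMap.adjoint f ∘L f :=
    (ContinuousLinearMap.nonneg_iff_isPositive _).mpr f.isPositive_adjoint_comp_self
  have hqc : Continuous fun x : ℝ => q.eval (x ^ 2) := by fun_prop
  have h1 : ∫ x, q.eval (x ^ 2) ∂μ =
      q.sum fun n a => a * reTrace e ((ContinuousLinearMap.adjoint f ∘L f) ^ n) := by
    -- `q(x²)` evaluated at `|f|` is `q(f* f)`.
    have : cfc (fun x : ℝ => q.eval (x ^ 2)) (absOperator f) =
        Polynomial.aeval (ContinuousLinearMap.adjoint f ∘L f) q := by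
      rw [cfc_comp_pow (fun y => q.eval y) 2 _ (by fun_prop) hsa, cfc_polynomial q _ (hsa.pow 2),
        sq, absOperator, CFC.sqrt_mul_sqrt_self _ hpos]
    rw [hint _ hqc.continuousOn, this, Polynomial.aeval_eq_sum_range, map_sum,
      Polynomial.sum_over_range]
    · exact Finset.sum_congr rfl fun n _ => by rw [map_smul, smul_eq_mul]
    · simp
  have h2 : μ.real Set.univ = ∑ i, ‖e i‖ ^ 2 := by
    -- The total mass is the trace of the identity.
    have := hint (fun _ => 1) continuousOn_const
    rw [cfc_const_one ℝ _ hsa, reTrace_one] at this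
    simpa using this
  rw [hres, ← h1, ← integral_sub (hbdd _ hlog) (hbdd _ hqc.continuousOn), ← h2, ← Real.norm_eq_abs]
  refine norm_integral_le_of_norm_le_const (hmem.mono fun x hx => ?_)
  rw [norm_sub_rev]
  exact hq x hx

end VectorTrace

/-! ### The norm, the involution and quotient maps of `L¹(G)` -/

namespace L1

variable {G : Type u} {H : Type v}

/-- The norm `∑ |λ_g|` of `∑ λ_g · g`. -/
noncomputable def norm1 (a : L1 G) : ℝ := ∑' g, ‖a.coeff g‖

theorem norm1_nonneg (a : L1 G) : 0 ≤ norm1 a := tsum_nonneg fun _ => norm_nonneg _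

theorem norm1_pushforward_le (φ : G → H) (a : L1 G) : norm1 (pushforward φ a) ≤ norm1 a := by
  classical
  have hs := summable_map_aux φ a
  calc norm1 (pushforward φ a)
      ≤ ∑' h, ∑' g, ‖if φ g = h then a.coeff g else 0‖ :=
        (pushforward φ a).summable_norm.tsum_le_tsum
          (fun h => norm_tsum_le_tsum_norm (hs.prod_symm.prod_factor h)) hs.prod_symm.prod
    _ = ∑' g, ∑' h, ‖if φ g = h then a.coeff g else 0‖ := hs.tsum_comm
    _ = norm1 a := tsum_congr fun g => by
        rw [tsum_eq_single (φ g) fun h hh => by simp [Ne.symm hh]]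
        simp

variable [Group G] [Group H]

/-- The involution `∑ λ_g · g ↦ ∑ conj(λ_g) · g⁻¹`. -/
noncomputable instance : Star (L1 G) :=
  ⟨fun a => ⟨fun g => star (a.coeff g⁻¹), by
    simpa only [norm_star, Function.comp_def, Equiv.inv_apply] using
      (Equiv.inv G).summable_iff.mpr a.summable_norm⟩⟩

theorem star_coeff (a : L1 G) (g : G) : (star a).coeff g = star (a.coeff g⁻¹) := rfl

theorem map_star (φ : G →* H) (a : L1 G) : map φ (star a) = star (map φ a) := by
  classical
  ext h
  change (pushforward φ (star a)).coeff h = star ((pushforward φ a).coeff h⁻¹)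
  rw [pushforward_coeff, pushforward_coeff, tsum_star, ← (Equiv.inv G).tsum_eq]
  refine tsum_congr fun g => ?_
  by_cases h : φ g = h⁻¹ <;> simp [star_coeff, inv_eq_iff_eq_inv, h]

/-- Along a decreasing family of normal subgroups with trivial intersection, the coefficient at
the unit element of the image in `L¹(G/G_i)` converges: it is the sum of the coefficients over
`G_i`, and dominated convergence applies. -/
theorem tendsto_map_mk_coeff_one {I : Type*} [Preorder I] (N : I → Subgroup G)
    [∀ i, (N i).Normal] (hanti : Antitone N) (hinter : ⨅ i, N i = ⊥) (a : L1 G) :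
    Tendsto (fun i => (map (QuotientGroup.mk' (N i)) a).coeff 1) atTop (𝓝 (a.coeff 1)) := by
  classical
  have h1 : a.coeff 1 = ∑' g, if g = 1 then a.coeff g else 0 := by simp
  rw [h1]
  refine tendsto_tsum_of_dominated_convergence a.summable_norm (fun g => ?_)
    (.of_forall fun i g => ?_)
  · by_cases hg : g = 1
    · simpa [hg] using tendsto_const_nhds
    · obtain ⟨i, hi⟩ : ∃ i, g ∉ N i := by
        by_contra! h
        exact hg (by simpa [hinter] using Subgroup.mem_iInf.mpr h)
      refine tendsto_const_nhds.congr' ?_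
      filter_upwards [eventually_ge_atTop i] with j hj
      have : g ∉ N j := fun h => hi (hanti hj h)
      simp [hg, this]
  · split_ifs <;> simp

end L1

/-! ### Right multiplication as an anti-homomorphism compatible with adjoints -/

section RightMultiplication

variable {G : Type u} [Group G]

theorem rightMul_zero : rightMul (0 : L1 G) = 0 := by simp [rightMul]

theorem rightMul_add (a b : L1 G) : rightMul (a + b) = rightMul a + rightMul b := by
  simp only [rightMul, L1.add_coeff, add_smul]
  exact (summable_rightMul a).tsum_add (summable_rightMul b)

theorem rightMul_sum {ι : Type*} (s : Finset ι) (a : ι → L1 G) :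
    rightMul (∑ i ∈ s, a i) = ∑ i ∈ s, rightMul (a i) :=
  map_sum (AddMonoidHom.mk' rightMul rightMul_add) a s

theorem rightMul_one : rightMul (1 : L1 G) = ContinuousLinearMap.id ℂ (L2 G) := by
  classical
  rw [rightMul, tsum_eq_single 1 fun h hh => by simp [L1.one_coeff, hh]]
  ext x g
  simp [L1.one_coeff]

theorem norm_rightMul_le (a : L1 G) : ‖rightMul a‖ ≤ L1.norm1 a :=
  tsum_of_norm_bounded a.summable_norm.hasSum fun h => by
    rw [norm_smul]
    exact mul_le_of_le_one_right (norm_nonneg _)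
      (LinearIsometry.norm_toContinuousLinearMap_le _)

theorem rightTranslation_comp (h k : G) :
    (rightTranslation k).toContinuousLinearMap ∘L (rightTranslation h).toContinuousLinearMap =
      (rightTranslation (h * k)).toContinuousLinearMap := by
  ext x g
  simp [mul_assoc]

theorem adjoint_rightTranslation (h : G) :
    star (rightTranslation h).toContinuousLinearMap =
      (rightTranslation h⁻¹).toContinuousLinearMap := by
  rw [ContinuousLinearMap.star_eq_adjoint, eq_comm, ContinuousLinearMap.eq_adjoint_iff]
  intro x y
  simp only [lp.inner_eq_tsum]
  rw [← (Equiv.mulRight h⁻¹).tsum_eq]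
  simp

theorem rightMul_star (a : L1 G) : rightMul (star a) = star (rightMul a) := by
  rw [rightMul, rightMul, tsum_star, ← (Equiv.inv G).tsum_eq]
  refine tsum_congr fun h => ?_
  rw [star_smul, adjoint_rightTranslation]
  simp [L1.star_coeff]

theorem rightMul_mul (a b : L1 G) : rightMul (a * b) = rightMul b ∘L rightMul a := by
  have hs : Summable (Function.uncurry fun (y x : G) =>
      (a.coeff y * b.coeff (y⁻¹ * x)) • (rightTranslation x).toContinuousLinearMap) := by
    refine Summable.of_norm_bounded (L1.summable_mul_aux a b) fun p => ?_
    rw [Function.uncurry, norm_smul]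
    exact mul_le_of_le_one_right (norm_nonneg _)
      (LinearIsometry.norm_toContinuousLinearMap_le _)
  calc rightMul (a * b)
      = ∑' x, ∑' y, (a.coeff y * b.coeff (y⁻¹ * x)) •
          (rightTranslation x).toContinuousLinearMap :=
        tsum_congr fun x => ((L1.summable_mul_snd a b x).tsum_smul_const _).symm
    _ = ∑' y, ∑' x, (a.coeff y * b.coeff (y⁻¹ * x)) •
          (rightTranslation x).toContinuousLinearMap := hs.tsum_comm
    _ = ∑' y, rightMul b ∘L (a.coeff y • (rightTranslation y).toContinuousLinearMap) := by
        refine tsum_congr fun y => ?_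
        rw [← (Equiv.mulLeft y).tsum_eq, rightMul]
        refine Eq.trans ?_ (((ContinuousLinearMap.compL ℂ (L2 G) (L2 G) (L2 G)).flip
          (a.coeff y • (rightTranslation y).toContinuousLinearMap)).map_tsum
            (summable_rightMul b)).symm
        refine tsum_congr fun z => ?_
        simp [← rightTranslation_comp, smul_smul, mul_comm]
    _ = rightMul b ∘L rightMul a :=
        ((ContinuousLinearMap.compL ℂ (L2 G) (L2 G) (L2 G) (rightMul b)).map_tsum
          (summable_rightMul a)).symm

theorem rightMulMatrix_mul {r s t : ℕ} (A : Matrix (Fin r) (Fin s) (L1 G))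
    (B : Matrix (Fin s) (Fin t) (L1 G)) :
    rightMulMatrix (A * B) = rightMulMatrix B ∘L rightMulMatrix A := by
  refine ContinuousLinearMap.ext fun x => PiLp.ext fun j => ?_
  rw [ContinuousLinearMap.comp_apply, rightMulMatrix_apply, rightMulMatrix_apply]
  simp only [rightMulMatrix_apply, Matrix.mul_apply, rightMul_sum, rightMul_mul, map_sum,
    sum_apply, ContinuousLinearMap.comp_apply]
  exact Finset.sum_comm

theorem rightMulMatrix_one (d : ℕ) :
    rightMulMatrix (1 : Matrix (Fin d) (Fin d) (L1 G)) = 1 := by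
  refine ContinuousLinearMap.ext fun x => PiLp.ext fun j => ?_
  rw [rightMulMatrix_apply, Finset.sum_eq_single j]
  · simp [rightMul_one]
  · intro i _ hi
    simp [Matrix.one_apply_ne hi, rightMul_zero]
  · simp

theorem rightMulMatrix_pow {d : ℕ} (A : Matrix (Fin d) (Fin d) (L1 G)) (n : ℕ) :
    rightMulMatrix (A ^ n) = rightMulMatrix A ^ n := by
  induction n with
  | zero => rw [pow_zero, pow_zero, rightMulMatrix_one]
  | succ n ih => rw [pow_succ', pow_succ, rightMulMatrix_mul, ih]; rfl

theorem adjoint_rightMulMatrix {r s : ℕ} (A : Matrix (Fin r) (Fin s) (L1 G)) :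
    ContinuousLinearMap.adjoint (rightMulMatrix A) = rightMulMatrix A.conjTranspose := by
  rw [eq_comm, ContinuousLinearMap.eq_adjoint_iff]
  intro x y
  simp only [PiLp.inner_apply, rightMulMatrix_apply, sum_inner, inner_sum,
    Matrix.conjTranspose_apply, rightMul_star, ContinuousLinearMap.star_eq_adjoint,
    ContinuousLinearMap.adjoint_inner_left]
  exact Finset.sum_comm

/-- A bound of the operator norm of `r_A^{(2)}` by the `ℓ¹`-norms of the entries of `A`. It is not
sharp, but it does not increase when `A` is pushed forward along a group homomorphism. -/
theorem norm_rightMulMatrix_apply_le {r s : ℕ} (A : Matrix (Fin r) (Fin s) (L1 G))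
    (x : L2Pow G r) : ‖rightMulMatrix A x‖ ≤ (∑ j, ∑ i, L1.norm1 (A i j)) * ‖x‖ := by
  have h1 : ∀ j, ‖rightMulMatrix A x j‖ ≤ (∑ i, L1.norm1 (A i j)) * ‖x‖ := fun j => by
    rw [rightMulMatrix_apply, Finset.sum_mul]
    refine (norm_sum_le _ _).trans (Finset.sum_le_sum fun i _ => ?_)
    exact ((rightMul (A i j)).le_of_opNorm_le (norm_rightMul_le _) _).trans
      (mul_le_mul_of_nonneg_left (PiLp.norm_apply_le x i) (L1.norm1_nonneg _))
  refine le_trans ?_ ((Finset.sum_le_sum fun j _ => h1 j).trans_eq (Finset.sum_mul ..).symm)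
  rw [PiLp.norm_eq_of_L2]
  exact Real.sqrt_le_iff.mpr ⟨Finset.sum_nonneg fun _ _ => norm_nonneg _,
    Finset.sum_sq_le_sq_sum_of_nonneg fun _ _ => norm_nonneg _⟩

theorem norm_unitVector {d : ℕ} (i : Fin d) : ‖unitVector G d i‖ = 1 := by
  classical
  simp [unitVector, lp.norm_single]

theorem inner_unitVector_rightMulMatrix {d : ℕ} (C : Matrix (Fin d) (Fin d) (L1 G)) (k : Fin d) :
    inner ℂ (unitVector G d k) (rightMulMatrix C (unitVector G d k)) = (C k k).coeff 1 := by
  classical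
  have h1 : ∀ i, unitVector G d k i =
      if i = k then (lp.single 2 (1 : G) (1 : ℂ) : L2 G) else 0 := fun i => by
    simp [unitVector]
  rw [PiLp.inner_apply, Finset.sum_eq_single k (fun i _ hi => by simp [h1, hi]) (by simp),
    rightMulMatrix_apply, Finset.sum_eq_single k (fun i _ hi => by simp [h1, hi]) (by simp), h1,
    if_pos rfl, lp.inner_single_left, rightMul_apply,
    tsum_eq_single 1 fun h hh => by simp [lp.single_apply, hh]]
  simp [lp.single_apply]

end RightMultiplication

/-! ### Determinants of invertible matrices and their limits -/

section Determinant

variable {G : Type u} [Group G] {d : ℕ}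

/-- The function in this statement is, by definition, the spectral density function of `f`. -/
theorem monotone_reTrace_unitVector (f : L2Pow G d →L[ℂ] L2Pow G d) :
    Monotone fun t => reTrace (unitVector G d) (spectralProjection (absOperator f) t) :=
  spectralDensity_mono f

/-- If `A * B = 1`, then `r_B^{(2)}` is a left inverse of `r_A^{(2)}`, so that a bound for `B`
bounds `r_A^{(2)}` from below. -/
theorem inv_mul_norm_le_norm_rightMulMatrix {A B : Matrix (Fin d) (Fin d) (L1 G)}
    (hAB : A * B = 1) {K : ℝ}
    (hK : 0 < K) (hB : ∑ j, ∑ i, L1.norm1 (B i j) ≤ K) (v : L2Pow G d) :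
    K⁻¹ * ‖v‖ ≤ ‖rightMulMatrix A v‖ := by
  have h : rightMulMatrix B (rightMulMatrix A v) = v := by
    rw [← ContinuousLinearMap.comp_apply, ← rightMulMatrix_mul, hAB, rightMulMatrix_one]
    rfl
  rw [inv_mul_le_iff₀ hK]
  calc ‖v‖ = ‖rightMulMatrix B (rightMulMatrix A v)‖ := by rw [h]
    _ ≤ _ := norm_rightMulMatrix_apply_le B _
    _ ≤ K * ‖rightMulMatrix A v‖ := by gcongr

theorem reTrace_pow_rightMulMatrix (A : Matrix (Fin d) (Fin d) (L1 G)) (n : ℕ) :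
    reTrace (unitVector G d)
        ((ContinuousLinearMap.adjoint (rightMulMatrix A) ∘L rightMulMatrix A) ^ n) =
      (∑ k, (((A * A.conjTranspose) ^ n) k k).coeff 1).re := by
  rw [adjoint_rightMulMatrix, ← rightMulMatrix_mul, ← rightMulMatrix_pow, reTrace_apply]
  simp only [inner_unitVector_rightMulMatrix]

/-- The Fuglede–Kadison determinant of an invertible matrix over `L¹(G)` is the exponential of a
number `ℓ`, which is approximated by the traces of the polynomials in `A A^*`; the quality of this
approximation depends only on `d` and on a bound `K` of the norms of the matrix and its inverse. -/
theorem exists_fugledeKadisonDet_eq_exp {A B : Matrix (Fin d) (Fin d) (L1 G)} (hAB : A * B = 1)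
    {K : ℝ} (hK : 0 < K) (hA : ∑ j, ∑ i, L1.norm1 (A i j) ≤ K)
    (hB : ∑ j, ∑ i, L1.norm1 (B i j) ≤ K) :
    ∃ ℓ : ℝ, fugledeKadisonDet (rightMulMatrix A) = Real.exp ℓ ∧
      ∀ (q : Polynomial ℝ) (ε : ℝ),
        (∀ x ∈ Set.Icc K⁻¹ K, |q.eval (x ^ 2) - Real.log x| ≤ ε) →
        |ℓ - q.sum fun n a => a * (∑ k, (((A * A.conjTranspose) ^ n) k k).coeff 1).re| ≤ ε * d := by
  obtain ⟨hint, h⟩ := abs_integral_log_sub_le (unitVector G d) (rightMulMatrix A) (inv_pos.mpr hK)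
    hK.le (inv_mul_norm_le_norm_rightMulMatrix hAB hK hB)
    (fun v => (norm_rightMulMatrix_apply_le A v).trans (by gcongr))
    (monotone_reTrace_unitVector _)
  refine ⟨_, if_pos hint, fun q ε hq => ?_⟩
  have := h q ε hq
  simp only [reTrace_pow_rightMulMatrix, norm_unitVector, one_pow, Finset.sum_const,
    Finset.card_univ, Fintype.card_fin, nsmul_eq_mul, mul_one] at this
  exact this

/-- A polynomial in `x²` that is uniformly close to `log x` on an interval of positive numbers. -/
theorem exists_polynomial_sq_near_log {c C ε : ℝ} (hc : 0 < c) (hε : 0 < ε) :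
    ∃ q : Polynomial ℝ, ∀ x ∈ Set.Icc c C, |q.eval (x ^ 2) - Real.log x| ≤ ε := by
  obtain ⟨q, hq⟩ := exists_polynomial_near_of_continuousOn (c ^ 2) (C ^ 2)
    (fun y => Real.log y / 2)
    ((Real.continuousOn_log.mono fun y hy => ((pow_pos hc 2).trans_le hy.1).ne').div_const 2) ε hε
  refine ⟨q, fun x hx => ?_⟩
  have hx0 : 0 < x := hc.trans_le hx.1
  have := hq (x ^ 2) ⟨pow_le_pow_left₀ hc.le hx.1 2, pow_le_pow_left₀ hx0.le hx.2 2⟩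
  rw [Real.log_pow, Nat.cast_ofNat, mul_div_cancel_left₀ _ two_ne_zero] at this
  exact this.le

end Determinant

end L2Approx

open L2Approx in
theorem mainTheorem6 {G : Type u} [Group G] {I : Type v} [Preorder I] [IsDirectedOrder I]
    [Nonempty I] (N : I → Subgroup G) [∀ i, (N i).Normal] (hanti : Antitone N)
    (hinter : ⨅ i, N i = ⊥) (d : ℕ) (A : (Matrix (Fin d) (Fin d) (L1 G))ˣ) :
    Tendsto
      (fun i => fugledeKadisonDet (rightMulMatrix
        (Units.map (L1.map (QuotientGroup.mk' (N i))).mapMatrix.toMonoidHom A).val))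
      atTop (𝓝 (fugledeKadisonDet (rightMulMatrix A.val))) := by
  set φ : ∀ i, L1 G →+* L1 (G ⧸ N i) := fun i => L1.map (QuotientGroup.mk' (N i)) with hφ
  set M : Matrix (Fin d) (Fin d) (L1 G) := A.val with hM
  set B : Matrix (Fin d) (Fin d) (L1 G) := A⁻¹.val with hB
  -- One bound for `A`, its inverse, and their images over all quotients; `1` is added to make it
  -- positive.
  let K : ℝ := ∑ j, ∑ i, L1.norm1 (M i j) + ∑ j, ∑ i, L1.norm1 (B i j) + 1
  have hMnn : 0 ≤ ∑ j, ∑ i, L1.norm1 (M i j) :=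
    Finset.sum_nonneg fun _ _ => Finset.sum_nonneg fun _ _ => L1.norm1_nonneg _
  have hBnn : 0 ≤ ∑ j, ∑ i, L1.norm1 (B i j) :=
    Finset.sum_nonneg fun _ _ => Finset.sum_nonneg fun _ _ => L1.norm1_nonneg _
  have hMK : ∑ j, ∑ i, L1.norm1 (M i j) ≤ K := by simp only [K]; linarith
  have hBK : ∑ j, ∑ i, L1.norm1 (B i j) ≤ K := by simp only [K]; linarith
  have hK : 0 < K := by simp only [K]; linarith
  have hmap : ∀ i (C : Matrix (Fin d) (Fin d) (L1 G)),
      ∑ l, ∑ k, L1.norm1 ((φ i).mapMatrix C k l) ≤ ∑ l, ∑ k, L1.norm1 (C k l) := fun i C =>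
    Finset.sum_le_sum fun _ _ => Finset.sum_le_sum fun _ _ => L1.norm1_pushforward_le _ _
  have hMB : M * B = 1 := A.mul_inv
  obtain ⟨ℓ, hℓ, happ⟩ := exists_fugledeKadisonDet_eq_exp hMB hK hMK hBK
  have hi : ∀ i, (φ i).mapMatrix M * (φ i).mapMatrix B = 1 := fun i => by
    rw [← map_mul, hMB, map_one]
  choose ℓi hℓi happi using fun i => exists_fugledeKadisonDet_eq_exp (hi i) hK
    ((hmap i M).trans hMK) ((hmap i B).trans hBK)
  have hstar : ∀ i, (φ i).mapMatrix M * ((φ i).mapMatrix M).conjTranspose =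
      (φ i).mapMatrix (M * M.conjTranspose) := fun i => by
    rw [map_mul]
    congr 1
    refine Matrix.ext fun k l => ?_
    exact (L1.map_star (QuotientGroup.mk' (N i)) (M l k)).symm
  have htrace : ∀ n : ℕ, Tendsto (fun i => (∑ k, ((((φ i).mapMatrix M *
      ((φ i).mapMatrix M).conjTranspose) ^ n) k k).coeff 1).re) atTop
      (𝓝 (∑ k, (((M * M.conjTranspose) ^ n) k k).coeff 1).re) := fun n => by
    simp only [hstar, ← map_pow]
    exact (Complex.continuous_re.tendsto _).comp (tendsto_finsetSum _ fun k _ =>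
      L1.tendsto_map_mk_coeff_one N hanti hinter _)
  have hlim : Tendsto ℓi atTop (𝓝 ℓ) := by
    rw [Metric.tendsto_nhds]
    intro ε hε
    -- With this precision, each of the two approximations costs less than `ε / 3`.
    have hδ : 0 < ε / (3 * (d + 1)) := by positivity
    obtain ⟨q, hq⟩ := exists_polynomial_sq_near_log (C := K) (inv_pos.mpr hK) hδ
    have hsum : Tendsto (fun i => q.sum fun n a => a * (∑ k, ((((φ i).mapMatrix M *
        ((φ i).mapMatrix M).conjTranspose) ^ n) k k).coeff 1).re) atTop
        (𝓝 (q.sum fun n a => a * (∑ k, (((M * M.conjTranspose) ^ n) k k).coeff 1).re)) :=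
      tendsto_finsetSum _ fun n _ => (htrace n).const_mul _
    have hd : ε / (3 * (d + 1)) * d < ε / 3 := by
      rw [div_mul_eq_mul_div, div_lt_div_iff₀ (by positivity) (by positivity)]
      nlinarith
    filter_upwards [Metric.tendsto_nhds.mp hsum (ε / 3) (by positivity)] with i hclose
    have h1 := happ q _ hq
    have h2 := happi i q _ hq
    rw [Real.dist_eq] at hclose ⊢
    rw [abs_le] at h1 h2
    rw [abs_lt] at hclose ⊢
    constructor <;> linarith [h1.1, h1.2, h2.1, h2.2, hclose.1, hclose.2]
  rw [hℓ]
  exact ((Real.continuous_exp.tendsto _).comp hlim).congr fun i => (hℓi i).symm
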